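/- Let $f(\cdot;\theta_f):\mathbb{R}^d\to\mathbb{R}^d$ be a parametrized vector field and consider $h(t)=h(0)+\int_0^t f(h(s);\theta_f)\,ds$. Let $H\subseteq\mathbb{R}^d$ be a closed set (for instance a compact set, or $\mathbb{R}^d$), the state space, and let $c_1,\dots,c_L\in H$ be pairwise distinct points. Let $W_i(h)=W(h,c_i;\theta_W)$ be parametrized functions, let $D_{W_i}=\{h\in H: W_i(h)<1\}$ be the prescribed region of attraction of class $i$, let $\Phi_i$ be real functions on $D_{W_i}$, and define the consistency loss $$\mathcal{L}_{con}(\theta_f,\theta_W)=\sum_{i=1}^L\ \sup_{h\in D_{W_i}}\Big\|\frac{dW_i(h)}{dh}f(h;\theta_f)+\Phi_i(h)\,(1-W_i(h))\Big\|_2^2\in[0,\infty].$$ Let $\theta^*=(\theta_f,\theta_W)$ be parameters such that: 1. $f(\cdot;\theta_f)$ is Lipschitz continuous, and every solution that starts in $H$ stays in $H$ in forward time; 2. each $W_i$ is a continuous function $H\to[0,1]$, differentiable (relative to $H$) at the points of $D_{W_i}$, with $W_i(c_i)=0$, $W_i(h)>0$ for $h\in H\setminus\{c_i\}$, and $W_i(h)\to1$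 as $\|h\|\to\infty$ in $H$ (which is automatic if $H$ is compact); 3. each $\Phi_i$ is continuous on $D_{W_i}$, with $\Phi_i(c_i)=0$ and $\Phi_i(h)>0$ for $h\in D_{W_i}\setminus\{c_i\}$. If $\mathcal{L}_{con}(\theta^*)=0$, then $D_{W_i}\cap D_{W_j}=\emptyset$ for all $i\ne j$. -/

import Mathlib

open Set Filter Topology
open scoped ENNReal NNReal

noncomputable section

namespace ZubovNet

variable {E : Type*} [NormedAddCommGroup E] [NormedSpace ℝ E]

/-- `γ` solves the autonomous equation `γ t = γ 0 + ∫₀ᵗ f (γ s) ds` on `[0, T]`. -/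
def IsSolutionOn (f : E → E) (T : ℝ) (γ : ℝ → E) : Prop :=
  ContinuousOn γ (Icc 0 T) ∧ ∀ t ∈ Icc 0 T, γ t = γ 0 + ∫ s in (0 : ℝ)..t, f (γ s)

/-- `H` is a state space for the equation driven by `f`: solutions that start in `H`
have all their states in `H`. -/
def IsStateSpace (f : E → E) (H : Set E) : Prop :=
  ∀ (T : ℝ) (γ : ℝ → E), IsSolutionOn f T γ → γ 0 ∈ H → ∀ t ∈ Icc 0 T, γ t ∈ H

/-- `V` is positive definite on `S` with respect to the point `c`. -/
def PosDefAt (S : Set E) (c : E) (V : E → ℝ) : Prop :=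
  V c = 0 ∧ ∀ h ∈ S, h ≠ c → 0 < V h

/-- The prescribed region of attraction `D_W`: the strict sublevel-1 set of `W` in `H`. -/
def PRoA (H : Set E) (W : E → ℝ) : Set E :=
  {h ∈ H | W h < 1}

/-- `W : H → [0, 1]` is a (Zubov-type) Lyapunov function for the point `c`. -/
structure IsLyapunov (H : Set E) (c : E) (W : E → ℝ) : Prop where
  mem : c ∈ H
  mapsTo : MapsTo W H (Icc 0 1)
  continuousOn : ContinuousOn W H
  differentiable : ∀ h ∈ PRoA H W, DifferentiableWithinAt ℝ W H h
  posDef : PosDefAt H c W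
  /-- `W h → 1` as `‖h‖ → ∞` in `H`; this is automatic when `H` is bounded. -/
  tendsto_one : Tendsto W (Bornology.cobounded E ⊓ 𝓟 H) (𝓝 1)

/-- The pointwise consistency loss `‖(dW/dh) f(h) + Φ(h) (1 - W(h))‖²`. -/
def pointLoss (H : Set E) (f : E → E) (W Φ : E → ℝ) (h : E) : ℝ :=
  ‖fderivWithin ℝ W H h (f h) + Φ h * (1 - W h)‖ ^ 2

/-- The consistency loss `∑ᵢ sup_{h ∈ D_{Wᵢ}} lᵢ(h)` with `Wᵢ = W(·, cᵢ; θW)`, as a function of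
`(θf, θW)`. It takes values in `[0, ∞]`, so that an unbounded supremum is `∞`. -/
def consistencyLoss {ΘF ΘW : Type*} {L : ℕ} (H : Set E) (c : Fin L → E) (Φ : Fin L → E → ℝ)
    (f : E → ΘF → E) (W : E → E → ΘW → ℝ) (θf : ΘF) (θW : ΘW) : ℝ≥0∞ :=
  ∑ i, ⨆ h ∈ PRoA H (fun h => W h (c i) θW),
    ENNReal.ofReal (pointLoss H (fun h => f h θf) (fun h => W h (c i) θW) (Φ i) h)

end ZubovNet

end

/-!
Vanishing of the loss is the Zubov equation `(dWᵢ/dh) f = -Φᵢ (1 - Wᵢ)` on `D_{Wᵢ}`, so `1 - Wᵢ`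
grows along `f` at the rate `Φᵢ`, and the product `(1 - Wᵢ) (1 - Wⱼ)` grows at the rate `Φᵢ + Φⱼ`,
which is positive everywhere on `D_{Wᵢ} ∩ D_{Wⱼ}` because `cᵢ ≠ cⱼ`. If the intersection were
nonempty, the product would have a local maximum on `H` at one of its points, since it tends to `0`
at infinity. This contradicts Fermat's theorem in the direction `f`, which is tangent to `H` because
solutions do not leave `H` (Nagumo's condition).
-/

namespace ZubovNet

section Product

variable {X : Type*} [TopologicalSpace X] {H : Set X} {u v : X → ℝ}

theorem exists_isLocalMaxOn_mul (hH : IsClosed H) (hu : ContinuousOn u H) (hv : ContinuousOn v H)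
    (hu₀ : Tendsto u (cocompact X ⊓ 𝓟 H) (𝓝 0)) (hv₀ : Tendsto v (cocompact X ⊓ 𝓟 H) (𝓝 0))
    {x : X} (hx : x ∈ H) (hux : 0 < u x) (hvx : 0 < v x) :
    ∃ y ∈ H, 0 < u y ∧ 0 < v y ∧ IsLocalMaxOn (fun z ↦ u z * v z) H y := by
  -- Positive parts keep a product of two negative values from competing for the maximum.
  set p : X → ℝ := fun z ↦ max (u z) 0 * max (v z) 0
  have hp : ContinuousOn p H := (hu.sup continuousOn_const).mul (hv.sup continuousOn_const)
  have hp₀ : Tendsto p (cocompact X ⊓ 𝓟 H) (𝓝 0) := by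
    simpa using (hu₀.max (tendsto_const_nhds (x := 0))).mul (hv₀.max (tendsto_const_nhds (x := 0)))
  have hpx : 0 < p x := mul_pos (lt_max_of_lt_left hux) (lt_max_of_lt_left hvx)
  obtain ⟨y, hy, hmax⟩ := hp.exists_isMaxOn' hH hx (hp₀.eventually (ge_mem_nhds hpx))
  have hpy : 0 < p y := hpx.trans_le (hmax hx)
  have huy : 0 < u y := by
    by_contra! h
    simp [p, max_eq_right h] at hpy
  have hvy : 0 < v y := by
    by_contra! h
    simp [p, max_eq_right h] at hpy
  refine ⟨y, hy, huy, hvy, ?_⟩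
  have heq : p =ᶠ[𝓝[H] y] fun z ↦ u z * v z := by
    filter_upwards [(hu y hy).eventually (lt_mem_nhds huy),
      (hv y hy).eventually (lt_mem_nhds hvy)] with z hz hz'
    simp only [p, max_eq_left hz.le, max_eq_left hz'.le]
  exact hmax.localize.congr heq hy

end Product

section PosDef

variable {X : Type*} {S S' : Set X} {c c' y : X} {V V' : X → ℝ}

theorem PosDefAt.nonneg (hV : PosDefAt S c V) (hy : y ∈ S) : 0 ≤ V y := by
  rcases eq_or_ne y c with rfl | hne
  · exact hV.1.ge
  · exact (hV.2 y hy hne).le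

theorem PosDefAt.add_pos (hV : PosDefAt S c V) (hV' : PosDefAt S' c' V')
    (hcc' : c ≠ c') (hy : y ∈ S) (hy' : y ∈ S') : 0 < V y + V' y := by
  rcases eq_or_ne y c with rfl | hne
  · exact add_pos_of_nonneg_of_pos (hV.nonneg hy) (hV'.2 y hy' hcc')
  · exact add_pos_of_pos_of_nonneg (hV.2 y hy hne) (hV'.nonneg hy')

end PosDef

variable {E : Type*} [NormedAddCommGroup E] [NormedSpace ℝ E]

section Tangency

variable {f : E → E} {H : Set E} {x : E}

theorem mapsTo_posTangentConeAt_of_hasFDerivWithinAt {F : Type*} [NormedAddCommGroup F]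
    [NormedSpace ℝ F] {g : F → E} {g' : F →L[ℝ] E} {s : Set F} {a : F}
    (hg : HasFDerivWithinAt g g' s a) :
    MapsTo g' (posTangentConeAt s a) (posTangentConeAt (g '' s) (g a)) := by
  intro y hy
  obtain ⟨ι, l, hl, c, d, hd₀, hds, hcd⟩ := exists_fun_of_mem_tangentConeAt hy
  have hd : Tendsto (fun n ↦ a + d n) l (𝓝[s] a) :=
    tendsto_nhdsWithin_iff.2 ⟨by simpa using tendsto_const_nhds.add hd₀, hds⟩
  refine mem_tangentConeAt_of_seq l c (fun n ↦ g (a + d n) - g a) ?_ ?_ (hg.lim hd₀ hds hcd)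
  · exact tendsto_sub_nhds_zero_iff.2 (hg.continuousWithinAt.tendsto.comp hd)
  · exact hds.mono fun n hn ↦ ⟨a + d n, hn, by simp⟩

theorem exists_hasDerivWithinAt_of_lipschitzOnWith [CompleteSpace E] {K : ℝ≥0} {s : Set E}
    (hs : s ∈ 𝓝 x) (hf : LipschitzOnWith K f s) :
    ∃ τ > 0, ∃ γ : ℝ → E, γ 0 = x ∧
      ∀ t ∈ Icc 0 τ, HasDerivWithinAt γ (f (γ t)) (Icc 0 τ) t := by
  obtain ⟨r, hr, hrs⟩ := Metric.nhds_basis_closedBall.mem_iff.1 hs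
  lift r to ℝ≥0 using hr.le
  set M : ℝ≥0 := K * r + ‖f x‖₊ + 1
  have hbound : ∀ y ∈ Metric.closedBall x r, ‖f y‖ ≤ M := fun y hy ↦
    calc
      ‖f y‖ ≤ ‖f y - f x‖ + ‖f x‖ := norm_le_norm_sub_add _ _
      _ ≤ K * ‖y - x‖ + ‖f x‖ := by gcongr; exact hf.norm_sub_le (hrs hy) (mem_of_mem_nhds hs)
      _ ≤ K * r + ‖f x‖ := by gcongr; exact mem_closedBall_iff_norm.1 hy
      _ ≤ M := le_add_of_nonneg_right zero_le_one
  have hM : (0 : ℝ) < M := by positivity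
  have hτ : (0 : ℝ) < r / M := div_pos hr hM
  have hpl : IsPicardLindelof (fun _ ↦ f) (⟨0, le_rfl, hτ.le⟩ : Icc (0 : ℝ) (r / M)) x r 0 M K := by
    refine .of_time_independent hbound (hf.mono hrs) ?_
    rw [sub_zero, sub_zero, max_eq_left hτ.le, mul_div_cancel₀ _ hM.ne', NNReal.coe_zero, sub_zero]
  obtain ⟨γ, h₀, hγ⟩ := hpl.exists_eq_forall_mem_Icc_hasDerivWithinAt₀
  exact ⟨r / M, hτ, γ, h₀, hγ⟩

theorem isSolutionOn_of_hasDerivWithinAt [CompleteSpace E] {τ : ℝ} {γ : ℝ → E} (hf : Continuous f)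
    (hγ : ∀ t ∈ Icc 0 τ, HasDerivWithinAt γ (f (γ t)) (Icc 0 τ) t) : IsSolutionOn f τ γ := by
  have hcont : ContinuousOn γ (Icc 0 τ) := HasDerivWithinAt.continuousOn hγ
  refine ⟨hcont, fun t ht ↦ ?_⟩
  have hsub : Icc 0 t ⊆ Icc 0 τ := Icc_subset_Icc_right ht.2
  have hderiv : ∀ s ∈ Ioo 0 t, HasDerivAt γ (f (γ s)) s := fun s hs ↦
    (hγ s (hsub (Ioo_subset_Icc_self hs))).hasDerivAt (Icc_mem_nhds hs.1 (hs.2.trans_le ht.2))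
  have hint : IntervalIntegrable (fun s ↦ f (γ s)) MeasureTheory.volume 0 t :=
    (hf.comp_continuousOn (hcont.mono hsub)).intervalIntegrable_of_Icc ht.1
  rw [intervalIntegral.integral_eq_sub_of_hasDerivAt_of_le ht.1 (hcont.mono hsub) hderiv hint,
    add_sub_cancel]

theorem IsStateSpace.mem_posTangentConeAt [CompleteSpace E] (hinv : IsStateSpace f H)
    (hf : LocallyLipschitz f) (hx : x ∈ H) : f x ∈ posTangentConeAt H x := by
  obtain ⟨K, s, hs, hKs⟩ := hf x
  obtain ⟨τ, hτ, γ, rfl, hγ⟩ := exists_hasDerivWithinAt_of_lipschitzOnWith hs hKs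
  have hmem : MapsTo γ (Icc 0 τ) H :=
    hinv τ γ (isSolutionOn_of_hasDerivWithinAt hf.continuous hγ) hx
  have hcone : (1 : ℝ) ∈ posTangentConeAt (Icc 0 τ) 0 := by
    refine mem_posTangentConeAt_of_frequently_mem (Eventually.frequently ?_)
    filter_upwards [Ioc_mem_nhdsGT hτ] with t ht
    simpa using Ioc_subset_Icc_self ht
  have htangent :=
    mapsTo_posTangentConeAt_of_hasFDerivWithinAt (hγ 0 ⟨le_rfl, hτ.le⟩).hasFDerivWithinAt hcone
  simpa using posTangentConeAt_mono hmem.image_subset htangent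

end Tangency

section ZubovEquation

variable {f : E → E} {H : Set E} {W W' Φ Φ' : E → ℝ} {y : E}

theorem pointLoss_eq_zero_iff :
    pointLoss H f W Φ y = 0 ↔ fderivWithin ℝ W H y (f y) = -(Φ y * (1 - W y)) := by
  rw [pointLoss, sq_eq_zero_iff, norm_eq_zero, add_eq_zero_iff_eq_neg]

theorem add_nonpos_of_isLocalMaxOn_mul (hW : DifferentiableWithinAt ℝ W H y)
    (hW' : DifferentiableWithinAt ℝ W' H y) (hf : f y ∈ posTangentConeAt H y)
    (hlt : W y < 1) (hlt' : W' y < 1) (hloss : pointLoss H f W Φ y = 0)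
    (hloss' : pointLoss H f W' Φ' y = 0)
    (hmax : IsLocalMaxOn (fun z ↦ (1 - W z) * (1 - W' z)) H y) : Φ y + Φ' y ≤ 0 := by
  have hderiv := (hW.hasFDerivWithinAt.const_sub 1).mul (hW'.hasFDerivWithinAt.const_sub 1)
  have hfermat := hmax.hasFDerivWithinAt_nonpos hderiv hf
  simp only [add_apply, smul_apply,
    neg_apply, smul_eq_mul, pointLoss_eq_zero_iff.1 hloss,
    pointLoss_eq_zero_iff.1 hloss', neg_neg] at hfermat
  have hprod : (Φ y + Φ' y) * ((1 - W y) * (1 - W' y)) ≤ 0 := by linarith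
  exact nonpos_of_mul_nonpos_left hprod (mul_pos (sub_pos.2 hlt) (sub_pos.2 hlt'))

theorem consistencyLoss_eq_zero_iff {ΘF ΘW : Type*} {L : ℕ} {c : Fin L → E}
    {Φ : Fin L → E → ℝ} {f : E → ΘF → E} {W : E → E → ΘW → ℝ} {θf : ΘF} {θW : ΘW} :
    consistencyLoss H c Φ f W θf θW = 0 ↔ ∀ i, ∀ h ∈ PRoA H (fun h ↦ W h (c i) θW),
      pointLoss H (fun h ↦ f h θf) (fun h ↦ W h (c i) θW) (Φ i) h = 0 := by
  have hnonneg (i : Fin L) (h : E) :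
      0 ≤ pointLoss H (fun h ↦ f h θf) (fun h ↦ W h (c i) θW) (Φ i) h := sq_nonneg _
  simp only [consistencyLoss, Finset.sum_eq_zero_iff, Finset.mem_univ, true_imp_iff,
    ENNReal.iSup_eq_zero, ENNReal.ofReal_eq_zero, (hnonneg _ _).ge_iff_eq']

end ZubovEquation

end ZubovNet

theorem proposition4_general {E : Type*} [NormedAddCommGroup E] [NormedSpace ℝ E] [ProperSpace E]
    {L : ℕ} {ΘF ΘW : Type*} {H : Set E} (hH : IsClosed H) {c : Fin L → E}
    (hc : Function.Injective c) {f : E → ΘF → E} {W : E → E → ΘW → ℝ} {Φ : Fin L → E → ℝ}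
    {θf : ΘF} {θW : ΘW} (hf : ∀ h ∈ H, f h θf ∈ posTangentConeAt H h)
    (hWc : ∀ i, ContinuousOn (fun h => W h (c i) θW) H)
    (hWd : ∀ i, ∀ h ∈ ZubovNet.PRoA H (fun h => W h (c i) θW),
      DifferentiableWithinAt ℝ (fun h => W h (c i) θW) H h)
    (hW₁ : ∀ i, Tendsto (fun h => W h (c i) θW) (Bornology.cobounded E ⊓ 𝓟 H) (𝓝 1))
    (hΦ : ∀ i, ZubovNet.PosDefAt (ZubovNet.PRoA H (fun h => W h (c i) θW)) (c i) (Φ i))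
    (hloss : ZubovNet.consistencyLoss H c Φ f W θf θW = 0) (i j : Fin L) (hij : i ≠ j) :
    ZubovNet.PRoA H (fun h => W h (c i) θW) ∩ ZubovNet.PRoA H (fun h => W h (c j) θW) = ∅ := by
  rw [ZubovNet.consistencyLoss_eq_zero_iff] at hloss
  rw [eq_empty_iff_forall_notMem]
  rintro x ⟨⟨hx, hxi⟩, -, hxj⟩
  have hcont (k) : ContinuousOn (fun h ↦ 1 - W h (c k) θW) H := continuousOn_const.sub (hWc k)
  have hzero (k) : Tendsto (fun h ↦ 1 - W h (c k) θW) (cocompact E ⊓ 𝓟 H) (𝓝 0) := by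
    simpa [Metric.cobounded_eq_cocompact] using (hW₁ k).const_sub 1
  obtain ⟨y, hy, hyi, hyj, hmax⟩ := ZubovNet.exists_isLocalMaxOn_mul hH (hcont i) (hcont j)
    (hzero i) (hzero j) hx (sub_pos.2 hxi) (sub_pos.2 hxj)
  have hDi : y ∈ ZubovNet.PRoA H fun h ↦ W h (c i) θW := ⟨hy, sub_pos.1 hyi⟩
  have hDj : y ∈ ZubovNet.PRoA H fun h ↦ W h (c j) θW := ⟨hy, sub_pos.1 hyj⟩
  have hpos : 0 < Φ i y + Φ j y := (hΦ i).add_pos (hΦ j) (hc.ne hij) hDi hDj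
  have hnonpos : Φ i y + Φ j y ≤ 0 :=
    ZubovNet.add_nonpos_of_isLocalMaxOn_mul (hWd i y hDi) (hWd j y hDj) (hf y hy) hDi.2 hDj.2
      (hloss i y hDi) (hloss j y hDj) hmax
  exact hpos.not_ge hnonpos

theorem proposition4 {d L : ℕ} {ΘF ΘW : Type*}
    (H : Set (EuclideanSpace ℝ (Fin d))) (hH : IsClosed H)
    (c : Fin L → EuclideanSpace ℝ (Fin d)) (hc : Function.Injective c)
    (f : EuclideanSpace ℝ (Fin d) → ΘF → EuclideanSpace ℝ (Fin d))
    (W : EuclideanSpace ℝ (Fin d) → EuclideanSpace ℝ (Fin d) → ΘW → ℝ)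
    (Φ : Fin L → EuclideanSpace ℝ (Fin d) → ℝ)
    (θf : ΘF) (θW : ΘW)
    (hf : ∃ K : ℝ≥0, LipschitzWith K (fun h => f h θf))
    (hinv : ZubovNet.IsStateSpace (fun h => f h θf) H)
    (hW : ∀ i, ZubovNet.IsLyapunov H (c i) (fun h => W h (c i) θW))
    (hΦc : ∀ i, ContinuousOn (Φ i) (ZubovNet.PRoA H (fun h => W h (c i) θW)))
    (hΦ : ∀ i, ZubovNet.PosDefAt (ZubovNet.PRoA H (fun h => W h (c i) θW)) (c i) (Φ i))
    (hloss : ZubovNet.consistencyLoss H c Φ f W θf θW = 0) :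
    ∀ i j, i ≠ j →
      ZubovNet.PRoA H (fun h => W h (c i) θW) ∩ ZubovNet.PRoA H (fun h => W h (c j) θW) = ∅ := by
  obtain ⟨K, hK⟩ := hf
  exact proposition4_general hH hc (fun _ hh ↦ hinv.mem_posTangentConeAt hK.locallyLipschitz hh)
    (fun i ↦ (hW i).continuousOn) (fun i ↦ (hW i).differentiable) (fun i ↦ (hW i).tendsto_one)
    hΦ hloss
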